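/- Let $n$ be a positive integer, let $\mathcal{S}_n$ denote the real vector space of real symmetric $n\times n$ matrices, and let $$\mathrm{COP}_n=\{A\in\mathcal{S}_n : \mathbf{x}^TA\mathbf{x}\ge 0 \text{ for every entrywise nonnegative } \mathbf{x}\in\mathbb{R}^n\}$$ be the cone of copositive matrices. Call a square matrix monomial if each of its rows and each of its columns contains exactly one nonzero entry. Then a linear operator $\mathcal{L}:\mathcal{S}_n\to\mathcal{S}_n$ maps $\mathrm{COP}_n$ onto itself, that is, $\mathcal{L}(\mathrm{COP}_n)=\mathrm{COP}_n$, if and only if there is an entrywise nonnegative monomial matrix $Q\in\mathbb{R}^{n\times n}$ such that $$\mathcal{L}(A)=QAQ^T\quad\text{for all } A\in\mathcal{S}_n.$$ -/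

import Mathlib

open Matrix

/-- The real vector space of real symmetric `n × n` matrices, as a subspace of all real
`n × n` matrices. -/
def symMatrices (n : ℕ) : Submodule ℝ (Matrix (Fin n) (Fin n) ℝ) where
  carrier := {A | A.IsSymm}
  add_mem' hA hB := hA.add hB
  zero_mem' := Matrix.isSymm_zero
  smul_mem' c _ hA := hA.smul c

/-- The set of copositive matrices: real symmetric matrices `A` with `xᵀ A x ≥ 0` for every
entrywise nonnegative vector `x`. -/
def copositiveCone (n : ℕ) : Set (symMatrices n) :=
  {A | ∀ x : Fin n → ℝ, (∀ i, 0 ≤ x i) → 0 ≤ x ⬝ᵥ ((A : Matrix (Fin n) (Fin n) ℝ) *ᵥ x)}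

/-- A monomial matrix: exactly one nonzero entry in each row and in each column. -/
def IsMonomialMatrix {n : ℕ} (Q : Matrix (Fin n) (Fin n) ℝ) : Prop :=
  (∀ i, ∃! j, Q i j ≠ 0) ∧ (∀ j, ∃! i, Q i j ≠ 0)

/-- An entrywise nonnegative matrix. -/
def IsNonnegMatrix {n : ℕ} (Q : Matrix (Fin n) (Fin n) ℝ) : Prop :=
  ∀ i j, 0 ≤ Q i j

/-! The extreme rays of the dual of the copositive cone are spanned by the evaluations `A ↦ xᵀAx`
with `x ≥ 0`, `x ≠ 0`. The cone spans, so `L` is invertible and its adjoint permutes these rays: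
`xᵀL(A)x = T(x)ᵀ A T(x)` with `T(x) ≥ 0` (`exists_quadEval_comp`). Since `xᵀL(A)x` is quadratic in
`x`, the rank one matrices `T(x+sz)T(x+sz)ᵀ` form a quadratic path in `s`; nonnegativity then makes
`T` additive (`eq_add_of_rankOne_path`). So `T` is a nonnegative matrix `P`, and `L⁻¹` gives its
inverse, also nonnegative. This forces `P` to be monomial, and `Q = Pᵀ`. Conversely, a nonnegative
monomial matrix has a nonnegative inverse, so congruence by either one preserves copositivity. -/

/-- The linear functional `A ↦ xᵀ A x` on symmetric matrices. -/
def quadEval {n : ℕ} (x : Fin n → ℝ) : symMatrices n →ₗ[ℝ] ℝ where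
  toFun A := x ⬝ᵥ ((A : Matrix (Fin n) (Fin n) ℝ) *ᵥ x)
  map_add' A B := by simp [add_mulVec]
  map_smul' c A := by simp [smul_mulVec]

theorem quadEval_apply {n : ℕ} (x : Fin n → ℝ) (A : symMatrices n) :
    quadEval x A = x ⬝ᵥ ((A : Matrix (Fin n) (Fin n) ℝ) *ᵥ x) := rfl

theorem mem_copositiveCone {n : ℕ} {A : symMatrices n} :
    A ∈ copositiveCone n ↔ ∀ x : Fin n → ℝ, 0 ≤ x → 0 ≤ quadEval x A := Iff.rfl

/-- The symmetrized outer product `(u wᵀ + w uᵀ) / 2`. -/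
noncomputable def symOuter {n : ℕ} (u w : Fin n → ℝ) : symMatrices n :=
  ⟨(1 / 2 : ℝ) • (vecMulVec u w + vecMulVec w u), by
    change Matrix.IsSymm _
    ext i j
    simp [vecMulVec_apply]
    ring⟩

theorem symOuter_apply {n : ℕ} (u w : Fin n → ℝ) (i j : Fin n) :
    (symOuter u w : Matrix (Fin n) (Fin n) ℝ) i j = (u i * w j + w i * u j) / 2 := by
  simp [symOuter, vecMulVec_apply]
  ring

theorem quadEval_symOuter {n : ℕ} (x u w : Fin n → ℝ) :
    quadEval x (symOuter u w) = (u ⬝ᵥ x) * (w ⬝ᵥ x) := by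
  simp only [quadEval_apply, symOuter, smul_mulVec, add_mulVec, vecMulVec_mulVec, dotProduct_smul,
    dotProduct_add, smul_eq_mul, op_smul_eq_smul]
  rw [dotProduct_comm x u, dotProduct_comm x w]
  ring

theorem quadEval_smul {n : ℕ} (c : ℝ) (x : Fin n → ℝ) (A : symMatrices n) :
    quadEval (c • x) A = c ^ 2 * quadEval x A := by
  simp [quadEval_apply, mulVec_smul]
  ring

theorem quadEval_add_smul {n : ℕ} (x z : Fin n → ℝ) (s : ℝ) (A : symMatrices n) :
    quadEval (x + s • z) A = quadEval x A
      + s * (x ⬝ᵥ ((A : Matrix (Fin n) (Fin n) ℝ) *ᵥ z)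
        + z ⬝ᵥ ((A : Matrix (Fin n) (Fin n) ℝ) *ᵥ x))
      + s ^ 2 * quadEval z A := by
  simp [quadEval_apply, mulVec_smul, mulVec_add]
  ring

theorem sum_smul_symOuter {n : ℕ} (A : symMatrices n) :
    A = ∑ i, ∑ j, (A : Matrix (Fin n) (Fin n) ℝ) i j •
      symOuter (Pi.single i 1) (Pi.single j 1) := by
  have hA : (A : Matrix (Fin n) (Fin n) ℝ).IsSymm := A.2
  ext k l
  have h : ((∑ i, ∑ j, (A : Matrix (Fin n) (Fin n) ℝ) i j •
      symOuter (Pi.single i 1) (Pi.single j 1) : symMatrices n) : Matrix (Fin n) (Fin n) ℝ) k l =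
      ∑ i, ∑ j, (A : Matrix (Fin n) (Fin n) ℝ) i j *
        ((symOuter (Pi.single i 1) (Pi.single j 1) : symMatrices n) :
          Matrix (Fin n) (Fin n) ℝ) k l := by
    simp [Matrix.sum_apply]
  rw [h]
  simp_rw [symOuter_apply, Pi.single_apply]
  simp only [mul_ite, mul_one, mul_zero, add_div, mul_add, ite_div,
    zero_div, Finset.sum_add_distrib, Finset.sum_ite_eq, Finset.mem_univ, if_true]
  simp only [Finset.sum_ite_irrel, Finset.sum_ite_eq, Finset.mem_univ, if_true,
    Finset.sum_const_zero]
  rw [hA.apply]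
  ring

/-- Polarization: the squares `v vᵀ` span the symmetric matrices. -/
theorem linearMap_ext_symOuter {n : ℕ} {φ ψ : symMatrices n →ₗ[ℝ] ℝ}
    (h : ∀ v, φ (symOuter v v) = ψ (symOuter v v)) : φ = ψ := by
  have h2 (u w : Fin n → ℝ) : φ (symOuter u w) = ψ (symOuter u w) := by
    have e : symOuter u w =
        (1 / 2 : ℝ) • (symOuter (u + w) (u + w) - symOuter u u - symOuter w w) := by
      ext i j
      simp [symOuter_apply]
      ring
    rw [e]
    simp [h]
  ext A
  rw [sum_smul_symOuter A]
  simp [h2]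

/-! ### The copositive cone and its dual -/

theorem symOuter_single_mem {n : ℕ} (i j : Fin n) :
    symOuter (Pi.single i 1) (Pi.single j 1) ∈ copositiveCone n := by
  intro x hx
  change 0 ≤ quadEval x _
  rw [quadEval_symOuter]
  simpa using mul_nonneg (hx i) (hx j)

theorem symOuter_self_mem {n : ℕ} (v : Fin n → ℝ) : symOuter v v ∈ copositiveCone n := by
  intro x _
  change 0 ≤ quadEval x _
  rw [quadEval_symOuter]
  exact mul_self_nonneg _

theorem surjective_of_image_copositiveCone {n : ℕ} {L : symMatrices n →ₗ[ℝ] symMatrices n}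
    (hL : L '' copositiveCone n = copositiveCone n) : Function.Surjective L := by
  rw [← LinearMap.range_eq_top, eq_top_iff]
  intro A _
  rw [sum_smul_symOuter A]
  refine Submodule.sum_mem _ fun i _ => Submodule.sum_mem _ fun j _ => Submodule.smul_mem _ _ ?_
  have h := symOuter_single_mem i j
  rw [← hL] at h
  obtain ⟨B, _, hB⟩ := h
  exact ⟨B, hB⟩

theorem eq_of_quadEval_eq {n : ℕ} {x y : Fin n → ℝ} (hx : 0 ≤ x) (hy : 0 ≤ y)
    (h : ∀ A, quadEval x A = quadEval y A) : x = y := by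
  ext i
  have := h (symOuter (Pi.single i 1) (Pi.single i 1))
  simp only [quadEval_symOuter, single_one_dotProduct] at this
  exact (mul_self_inj (hx i) (hy i)).1 this

theorem continuous_quadEval {n : ℕ} (A : symMatrices n) :
    Continuous fun x : Fin n → ℝ => quadEval x A := by
  simp only [quadEval_apply]
  fun_prop

theorem mem_copositiveCone_of_stdSimplex {n : ℕ} {A : symMatrices n}
    (h : ∀ x ∈ stdSimplex ℝ (Fin n), 0 ≤ quadEval x A) : A ∈ copositiveCone n := by
  rw [mem_copositiveCone]
  intro x hx
  rcases eq_or_ne (∑ i, x i) 0 with h0 | h0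
  · have : x = 0 := by
      ext i
      exact (Finset.sum_eq_zero_iff_of_nonneg fun i _ => hx i).1 h0 i (Finset.mem_univ i)
    simp [this, quadEval_apply]
  · have := h ((∑ i, x i)⁻¹ • x)
      ⟨fun i => mul_nonneg (inv_nonneg.2 (Finset.sum_nonneg fun i _ => hx i)) (hx i), by
        simp [← Finset.mul_sum, h0]⟩
    rw [quadEval_smul] at this
    exact nonneg_of_mul_nonneg_right this (by positivity)

/-- A nonzero functional which is nonnegative on the copositive cone vanishes only at copositive
matrices that are annihilated by one common evaluation `A ↦ yᵀ A y`. -/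
theorem exists_quadEval_eq_zero {n : ℕ} [NeZero n] (φ : symMatrices n →ₗ[ℝ] ℝ)
    (hφ : ∀ A ∈ copositiveCone n, 0 ≤ φ A) {A₀ : symMatrices n} (hA₀ : φ A₀ < 0) :
    ∃ y ∈ stdSimplex ℝ (Fin n), ∀ A ∈ copositiveCone n, φ A = 0 → quadEval y A = 0 := by
  -- Otherwise finitely many copositive zeros of `φ` have a sum `C` positive on the whole simplex.
  -- Then `C` plus a small multiple of `A₀` is still copositive, but `φ` is negative there.
  by_contra! hcon
  have hS := isCompact_stdSimplex ℝ (Fin n)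
  have hne : (stdSimplex ℝ (Fin n)).Nonempty := ⟨_, single_mem_stdSimplex ℝ (0 : Fin n)⟩
  obtain ⟨t, ht⟩ := hS.elim_finite_subcover
    (fun A : {A : symMatrices n // A ∈ copositiveCone n ∧ φ A = 0} =>
      {y : Fin n → ℝ | 0 < quadEval y A.1})
    (fun A => isOpen_lt continuous_const (continuous_quadEval A.1)) (by
      intro y hy
      obtain ⟨A, hA, h0, h1⟩ := hcon y hy
      exact Set.mem_iUnion.2 ⟨⟨A, hA, h0⟩, lt_of_le_of_ne (hA y hy.1) h1.symm⟩)
  set C : symMatrices n := ∑ A ∈ t, A.1 with hC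
  have hφC : φ C = 0 := by
    rw [hC, map_sum]
    exact Finset.sum_eq_zero fun A _ => A.2.2
  have hCpos : ∀ y ∈ stdSimplex ℝ (Fin n), 0 < quadEval y C := by
    intro y hy
    obtain ⟨A, hA, hyA⟩ := Set.mem_iUnion₂.1 (ht hy)
    rw [hC, map_sum]
    exact Finset.sum_pos' (fun B _ => B.2.1 y hy.1) ⟨A, hA, hyA⟩
  obtain ⟨y₁, hy₁, hmin₁⟩ := hS.exists_isMinOn hne (continuous_quadEval C).continuousOn
  obtain ⟨y₂, hy₂, hmin₂⟩ := hS.exists_isMinOn hne (continuous_quadEval A₀).continuousOn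
  set m := quadEval y₁ C
  set M := |quadEval y₂ A₀| + 1
  have hm : 0 < m := hCpos y₁ hy₁
  have hM : 0 < M := by positivity
  have hmem : C + (m / M) • A₀ ∈ copositiveCone n := by
    refine mem_copositiveCone_of_stdSimplex fun y hy => ?_
    have h1 : m ≤ quadEval y C := hmin₁ hy
    have h2 : -M ≤ quadEval y A₀ := by
      have : quadEval y₂ A₀ ≤ quadEval y A₀ := hmin₂ hy
      have := neg_abs_le (quadEval y₂ A₀)
      simp only [M]
      linarith
    have h3 : m / M * (-M) ≤ m / M * quadEval y A₀ := by gcongr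
    rw [map_add, map_smul, smul_eq_mul]
    have h4 : m / M * (-M) = -m := by field_simp
    linarith
  have := hφ _ hmem
  rw [map_add, map_smul, hφC, zero_add, smul_eq_mul] at this
  exact absurd this (not_le.2 (mul_neg_of_pos_of_neg (by positivity) hA₀))

/-- Evaluations at nonnegative vectors are extreme in the dual of the copositive cone. -/
theorem exists_eq_smul_quadEval {n : ℕ} {x : Fin n → ℝ} (hx : x ≠ 0) (α : symMatrices n →ₗ[ℝ] ℝ)
    (hα : ∀ A ∈ copositiveCone n, 0 ≤ α A)
    (h0 : ∀ A ∈ copositiveCone n, quadEval x A = 0 → α A = 0) : ∃ c : ℝ, α = c • quadEval x := by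
  have hxx : x ⬝ᵥ x ≠ 0 := by simpa using hx
  set p : Fin n → ℝ := (x ⬝ᵥ x)⁻¹ • x with hp
  have hpx : p ⬝ᵥ x = 1 := by simp [hp, hxx]
  have hexp (c : ℝ) (w : Fin n → ℝ) : α (symOuter (c • p + w) (c • p + w)) =
      c ^ 2 * α (symOuter p p) + 2 * c * α (symOuter p w) + α (symOuter w w) := by
    have : symOuter (c • p + w) (c • p + w) =
        c ^ 2 • symOuter p p + (2 * c) • symOuter p w + symOuter w w := by
      ext i j
      simp [symOuter_apply]
      ring
    simp [this]
  refine ⟨α (symOuter p p), linearMap_ext_symOuter fun v => ?_⟩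
  set w := v - (v ⬝ᵥ x) • p with hw
  have hwx : w ⬝ᵥ x = 0 := by simp [hw, sub_dotProduct, hpx]
  have hww : α (symOuter w w) = 0 := h0 _ (symOuter_self_mem w) (by simp [quadEval_symOuter, hwx])
  -- `t²a + 2tb ≥ 0` for all `t` forces `b = 0`; dividing by `a + 1` below avoids the case `a = 0`.
  have hpw : α (symOuter p w) = 0 := by
    set a := α (symOuter p p)
    set b := α (symOuter p w)
    have ha : 0 ≤ a := hα _ (symOuter_self_mem p)
    have h1 (t : ℝ) : 0 ≤ t ^ 2 * a + 2 * t * b := by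
      have := hα _ (symOuter_self_mem (t • p + w))
      rw [hexp, hww] at this
      linarith
    have h2 := h1 (-b / (a + 1))
    have h3 : (-b / (a + 1)) ^ 2 * a + 2 * (-b / (a + 1)) * b =
        -(b ^ 2 * ((a + 2) / (a + 1) ^ 2)) := by
      field_simp
      ring
    rw [h3] at h2
    have h4 : 0 < (a + 2) / (a + 1) ^ 2 := by positivity
    have h5 : b ^ 2 ≤ 0 := by
      by_contra! h
      have := mul_pos h h4
      linarith
    exact pow_eq_zero_iff two_ne_zero |>.1 (le_antisymm h5 (sq_nonneg b))
  have hv : v = (v ⬝ᵥ x) • p + w := by simp [hw]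
  have := hexp (v ⬝ᵥ x) w
  rw [← hv, hpw, hww] at this
  rw [this, LinearMap.smul_apply, quadEval_symOuter, smul_eq_mul]
  ring

/-! ### The induced map on nonnegative vectors -/

/-- Compactness gives `y` vanishing wherever `quadEval x ∘ L` does on the cone. Pulled back by
`L⁻¹`, extremality of `quadEval x` makes the two proportional, and rescaling `y` absorbs the factor.
-/
theorem exists_quadEval_comp {n : ℕ} {L : symMatrices n →ₗ[ℝ] symMatrices n}
    (hL : L '' copositiveCone n = copositiveCone n) {x : Fin n → ℝ} (hx : 0 ≤ x) :
    ∃ y : Fin n → ℝ, 0 ≤ y ∧ ∀ A, quadEval x (L A) = quadEval y A := by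
  rcases eq_or_ne x 0 with rfl | hx0
  · exact ⟨0, le_rfl, fun A => by simp [quadEval_apply]⟩
  have : NeZero n := ⟨by rintro rfl; exact hx0 (Subsingleton.elim _ _)⟩
  have hsurj := surjective_of_image_copositiveCone hL
  let e := LinearEquiv.ofBijective L ⟨LinearMap.injective_iff_surjective.2 hsurj, hsurj⟩
  have hmem {A} (hA : A ∈ copositiveCone n) : L A ∈ copositiveCone n := hL ▸ ⟨A, hA, rfl⟩
  have hmem' {A} (hA : A ∈ copositiveCone n) : e.symm A ∈ copositiveCone n := by
    rw [← hL] at hA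
    obtain ⟨B, hB, rfl⟩ := hA
    have : e.symm (L B) = B := e.symm_apply_apply B
    rwa [this]
  have hLe (A) : L (e.symm A) = A := e.apply_symm_apply A
  obtain ⟨y, hy, hyA⟩ := exists_quadEval_eq_zero (quadEval x ∘ₗ L)
    (fun A hA => hmem hA x hx) (A₀ := e.symm (-symOuter x x)) (by
      rw [LinearMap.comp_apply, hLe, map_neg, quadEval_symOuter, neg_lt_zero]
      exact mul_self_pos.2 (by simpa using hx0))
  obtain ⟨c, hc⟩ := exists_eq_smul_quadEval hx0 (quadEval y ∘ₗ e.symm.toLinearMap)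
    (fun A hA => hmem' hA y hy.1)
    (fun A hA h => hyA _ (hmem' hA) (by simpa [hLe] using h))
  have hc' (A) : quadEval y A = c * quadEval x (L A) := by
    have := LinearMap.congr_fun hc (L A)
    have h2 : e.symm (L A) = A := e.symm_apply_apply A
    simpa [h2] using this
  have hcpos : 0 < c := by
    have h1 := hc' (symOuter y y)
    have h2 : 0 ≤ quadEval x (L (symOuter y y)) := hmem (symOuter_self_mem y) x hx
    have hy0 : y ⬝ᵥ y ≠ 0 := by
      intro h
      have := hy.2
      rw [dotProduct_self_eq_zero.1 h] at this
      simp at this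
    rw [quadEval_symOuter] at h1
    have h3 : 0 < c * quadEval x (L (symOuter y y)) := by
      rw [← h1]
      exact mul_self_pos.2 hy0
    exact pos_of_mul_pos_left h3 h2
  refine ⟨√(c⁻¹) • y, smul_nonneg (Real.sqrt_nonneg _) hy.1, fun A => ?_⟩
  rw [quadEval_smul, Real.sq_sqrt (by positivity), hc']
  field_simp

/-! ### Quadratic paths of rank one matrices -/

/-- Constant and quartic terms agree already, so three values of `s` determine the remaining
coefficients. -/
theorem rankOne_coeffs {N₁₂ N₁₁ N₂₂ a₁ a₂ b₁ b₂ : ℝ}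
    (h : ∀ s : ℝ, 0 ≤ s → (a₁ * a₂ + s * N₁₂ + s ^ 2 * (b₁ * b₂)) ^ 2 =
      (a₁ * a₁ + s * N₁₁ + s ^ 2 * (b₁ * b₁)) * (a₂ * a₂ + s * N₂₂ + s ^ 2 * (b₂ * b₂))) :
    2 * a₁ * a₂ * N₁₂ = a₁ ^ 2 * N₂₂ + a₂ ^ 2 * N₁₁ ∧
    N₁₂ ^ 2 + 2 * a₁ * a₂ * b₁ * b₂ = a₁ ^ 2 * b₂ ^ 2 + N₁₁ * N₂₂ + b₁ ^ 2 * a₂ ^ 2 ∧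
    2 * b₁ * b₂ * N₁₂ = b₁ ^ 2 * N₂₂ + b₂ ^ 2 * N₁₁ := by
  have h1 := h 1 (by norm_num)
  have h2 := h 2 (by norm_num)
  have h3 := h 3 (by norm_num)
  ring_nf at h1 h2 h3
  refine ⟨?_, ?_, ?_⟩ <;> linarith

/-- A quadratic path `s ↦ a aᵀ + s N + s² b bᵀ` of rank one matrices `y s (y s)ᵀ` with nonnegative
`y s`, `a`, `b` is `s ↦ (a + s b) (a + s b)ᵀ`. -/
theorem eq_add_of_rankOne_path {n : ℕ} {a b : Fin n → ℝ} {y : ℝ → Fin n → ℝ}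
    {N : (Fin n → ℝ) → (Fin n → ℝ) → ℝ} (ha : 0 ≤ a) (hb : 0 ≤ b) (hy : ∀ s, 0 ≤ s → 0 ≤ y s)
    (h : ∀ s, 0 ≤ s → ∀ u w : Fin n → ℝ, (u ⬝ᵥ y s) * (w ⬝ᵥ y s) =
      (u ⬝ᵥ a) * (w ⬝ᵥ a) + s * N u w + s ^ 2 * ((u ⬝ᵥ b) * (w ⬝ᵥ b)))
    {i j : Fin n} (hij : a j * b i < a i * b j) : y 1 = a + b := by
  have hco (u w : Fin n → ℝ) := rankOne_coeffs
    (a₁ := u ⬝ᵥ a) (a₂ := w ⬝ᵥ a) (b₁ := u ⬝ᵥ b) (b₂ := w ⬝ᵥ b)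
    (N₁₂ := N u w) (N₁₁ := N u u) (N₂₂ := N w w) (by
      intro s hs
      rw [← h s hs, ← h s hs, ← h s hs]
      ring)
  have hD : a i * b j - a j * b i ≠ 0 := by linarith
  -- `u`, `w` form a dual basis to `a`, `b`, by Cramer's rule on coordinates `i`, `j`.
  obtain ⟨u, hua, hub⟩ : ∃ u : Fin n → ℝ, u ⬝ᵥ a = 1 ∧ u ⬝ᵥ b = 0 := by
    refine ⟨(a i * b j - a j * b i)⁻¹ • (Pi.single i (b j) - Pi.single j (b i)), ?_, ?_⟩
    · simp only [smul_dotProduct, sub_dotProduct, single_dotProduct, smul_eq_mul]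
      rw [inv_mul_eq_one₀ hD]
      ring
    · simp only [smul_dotProduct, sub_dotProduct, single_dotProduct, smul_eq_mul]
      ring
  obtain ⟨w, hwa, hwb⟩ : ∃ w : Fin n → ℝ, w ⬝ᵥ a = 0 ∧ w ⬝ᵥ b = 1 := by
    refine ⟨(a i * b j - a j * b i)⁻¹ • (Pi.single j (a i) - Pi.single i (a j)), ?_, ?_⟩
    · simp only [smul_dotProduct, sub_dotProduct, single_dotProduct, smul_eq_mul]
      ring
    · simp only [smul_dotProduct, sub_dotProduct, single_dotProduct, smul_eq_mul]
      rw [inv_mul_eq_one₀ hD]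
  obtain ⟨h1, h2, h3⟩ := hco u w
  rw [hua, hwa] at h1
  rw [hua, hub, hwa, hwb] at h2
  rw [hub, hwb] at h3
  have hww : N w w = 0 := by linarith
  have huu : N u u = 0 := by linarith
  have huw : N u w ^ 2 = 1 := by rw [hww, huu] at h2; linarith
  have hspan (s : ℝ) (hs : 0 ≤ s) (k : Fin n) :
      y s k = (u ⬝ᵥ y s) * a k + (w ⬝ᵥ y s) * b k := by
    set v : Fin n → ℝ := Pi.single k 1 - a k • u - b k • w with hv
    have hva : v ⬝ᵥ a = 0 := by simp [hv, sub_dotProduct, hua, hwa]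
    have hvb : v ⬝ᵥ b = 0 := by simp [hv, sub_dotProduct, hub, hwb]
    have hvv : N v v = 0 := by
      have := (hco u v).1
      rw [hua, hva] at this
      linarith
    have hvy : v ⬝ᵥ y s = 0 := by
      have := h s hs v v
      rw [hva, hvb, hvv] at this
      exact mul_self_eq_zero.1 (by linarith)
    simp only [hv, sub_dotProduct, smul_dotProduct, single_one_dotProduct, smul_eq_mul] at hvy
    linarith
  have huy (s : ℝ) (hs : 0 ≤ s) : (u ⬝ᵥ y s) * (u ⬝ᵥ y s) = 1 := by
    rw [h s hs, hua, hub, huu]; ring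
  have hwy (s : ℝ) (hs : 0 ≤ s) : (w ⬝ᵥ y s) * (w ⬝ᵥ y s) = s ^ 2 := by
    rw [h s hs, hwa, hwb, hww]; ring
  have huwy (s : ℝ) (hs : 0 ≤ s) : (u ⬝ᵥ y s) * (w ⬝ᵥ y s) = s * N u w := by
    rw [h s hs, hua, hub, hwa, hwb]; ring
  -- If `N u w = -1`, then `y s = ±(a - s b)`. The `s` below makes coordinates `i` and `j` of `a - s
  -- b` opposite and nonzero, against `y s ≥ 0`.
  have hN : N u w = 1 := by
    rcases mul_self_eq_one_iff.1 ((pow_two _).symm.trans huw) with h' | h'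
    · exact h'
    exfalso
    have hai : 0 ≤ a i := ha i
    have haj : 0 ≤ a j := ha j
    have hbi : 0 ≤ b i := hb i
    have hbj : 0 ≤ b j := hb j
    have hbj' : 0 < b j := lt_of_le_of_ne hbj fun h0 => by
      rw [← h0] at hij
      nlinarith
    set s := (a i + a j) / (b i + b j) with hs_def
    have hs : 0 ≤ s := by positivity
    have h1 : 0 < a i - s * b i := by
      have : a i - s * b i = (a i * b j - a j * b i) / (b i + b j) := by
        rw [hs_def]; field_simp; ring
      rw [this]
      exact div_pos (by linarith) (by positivity)
    have h2 : a j - s * b j < 0 := by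
      have : a j - s * b j = -((a i * b j - a j * b i) / (b i + b j)) := by
        rw [hs_def]; field_simp; ring
      rw [this, neg_lt_zero]
      exact div_pos (by linarith) (by positivity)
    have h3 : y s i * y s j = (a i - s * b i) * (a j - s * b j) := by
      rw [hspan s hs i, hspan s hs j]
      have e1 := huy s hs
      have e2 := hwy s hs
      have e3 := huwy s hs
      rw [h'] at e3
      linear_combination a i * a j * e1 + b i * b j * e2 + (a i * b j + a j * b i) * e3
    have h4 : 0 ≤ y s i * y s j := mul_nonneg (hy s hs i) (hy s hs j)
    have := mul_neg_of_pos_of_neg h1 h2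
    linarith
  have h11 := huy 1 zero_le_one
  have h12 := huwy 1 zero_le_one
  rw [hN] at h12
  have heq : w ⬝ᵥ y 1 = u ⬝ᵥ y 1 := by
    have : u ⬝ᵥ y 1 ≠ 0 := by rintro h0; simp [h0] at h11
    exact mul_left_cancel₀ this (by linarith)
  ext k
  have hk := hspan 1 zero_le_one k
  rw [heq] at hk
  -- In the case `y 1 = -(a + b)`, nonnegativity makes both sides zero.
  rcases mul_self_eq_one_iff.1 h11 with h' | h'
  · rw [hk, h']; simp
  · have := hy 1 zero_le_one k
    have := ha k
    have := hb k
    rw [h'] at hk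
    simp only [Pi.zero_apply, Pi.add_apply] at *
    linarith

/-! ### Nonnegative inverses and monomial matrices -/

/-- In a pair of mutually inverse nonnegative matrices, each row of the first has exactly one nonzero
entry. -/
theorem existsUnique_ne_zero_of_nonneg_inverse {n : ℕ} {P R : Matrix (Fin n) (Fin n) ℝ}
    (hP : IsNonnegMatrix P) (hR : IsNonnegMatrix R) (hPR : P * R = 1) (hRP : R * P = 1)
    (i : Fin n) : ∃! j, P i j ≠ 0 := by
  have hzero {A B : Matrix (Fin n) (Fin n) ℝ} (hA : IsNonnegMatrix A) (hB : IsNonnegMatrix B)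
      (hAB : A * B = 1) {k l : Fin n} (hkl : k ≠ l) (m : Fin n) : A k m * B m l = 0 := by
    have h := congrFun (congrFun hAB k) l
    rw [one_apply_ne hkl, mul_apply] at h
    exact (Finset.sum_eq_zero_iff_of_nonneg fun m _ => mul_nonneg (hA k m) (hB m l)).1 h m
      (Finset.mem_univ m)
  have hex {A B : Matrix (Fin n) (Fin n) ℝ} (hAB : A * B = 1) (k : Fin n) :
      ∃ m, A k m * B m k ≠ 0 := by
    by_contra! h0
    have h := congrFun (congrFun hAB k) k
    rw [one_apply_eq, mul_apply, Finset.sum_eq_zero fun m _ => h0 m] at h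
    exact zero_ne_one h
  obtain ⟨j, hj⟩ := hex hPR i
  refine ⟨j, left_ne_zero_of_mul hj, fun k hk => ?_⟩
  by_contra hjk
  exact hk ((mul_eq_zero.1 (hzero hR hP hRP (Ne.symm hjk) i)).resolve_left
    (right_ne_zero_of_mul hj))

theorem isMonomialMatrix_of_nonneg_inverse {n : ℕ} {P R : Matrix (Fin n) (Fin n) ℝ}
    (hP : IsNonnegMatrix P) (hR : IsNonnegMatrix R) (hPR : P * R = 1) (hRP : R * P = 1) :
    IsMonomialMatrix P :=
  ⟨existsUnique_ne_zero_of_nonneg_inverse hP hR hPR hRP,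
    existsUnique_ne_zero_of_nonneg_inverse (P := Pᵀ) (R := Rᵀ) (fun i j => hP j i)
      (fun i j => hR j i) (by rw [← transpose_mul, hRP, transpose_one])
      (by rw [← transpose_mul, hPR, transpose_one])⟩

theorem IsMonomialMatrix.exists_nonneg_right_inverse {n : ℕ} {Q : Matrix (Fin n) (Fin n) ℝ}
    (hQ : IsMonomialMatrix Q) (hQ0 : IsNonnegMatrix Q) :
    ∃ R : Matrix (Fin n) (Fin n) ℝ, IsNonnegMatrix R ∧ Q * R = 1 := by
  -- Zero entries stay zero, since `0⁻¹ = 0`.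
  refine ⟨of fun j i => (Q i j)⁻¹, fun j i => inv_nonneg.2 (hQ0 i j), ?_⟩
  ext i k
  rw [mul_apply]
  simp only [of_apply]
  rcases eq_or_ne i k with rfl | hik
  · obtain ⟨j, hj, huniq⟩ := hQ.1 i
    rw [one_apply_eq, Finset.sum_eq_single j, mul_inv_cancel₀ hj]
    · intro l _ hl
      have : Q i l = 0 := by
        by_contra h
        exact hl (huniq l h)
      simp [this]
    · simp
  · rw [one_apply_ne hik]
    refine Finset.sum_eq_zero fun j _ => ?_
    by_contra h
    exact hik ((hQ.2 j).unique (left_ne_zero_of_mul h)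
      fun h0 => right_ne_zero_of_mul h (by simp [h0]))

theorem IsNonnegMatrix.mulVec_nonneg {n : ℕ} {M : Matrix (Fin n) (Fin n) ℝ} (hM : IsNonnegMatrix M)
    {x : Fin n → ℝ} (hx : 0 ≤ x) : 0 ≤ M *ᵥ x := by
  intro i
  have h : 0 ≤ ∑ j, M i j * x j := Finset.sum_nonneg fun j _ => mul_nonneg (hM i j) (hx j)
  exact h

/-! ### Linearity of the induced map -/

theorem eq_zero_of_quadEval_eq_zero {n : ℕ} {D : symMatrices n}
    (h : ∀ x, 0 ≤ x → quadEval x D = 0) : D = 0 := by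
  have hD : (D : Matrix (Fin n) (Fin n) ℝ).IsSymm := D.2
  have he (i : Fin n) : (0 : Fin n → ℝ) ≤ Pi.single i 1 := Pi.single_nonneg.2 zero_le_one
  ext i j
  have h1 := h (Pi.single i 1 + (1 : ℝ) • Pi.single j 1)
    (add_nonneg (he i) (smul_nonneg zero_le_one (he j)))
  rw [quadEval_add_smul, h _ (he i), h _ (he j)] at h1
  simp only [single_one_dotProduct, mulVec_single_one, col_apply] at h1
  have h2 := hD.apply i j
  simp only [ZeroMemClass.coe_zero, Matrix.zero_apply]
  linarith

theorem exists_nonneg_quadEval_mulVec {n : ℕ} {L : symMatrices n →ₗ[ℝ] symMatrices n}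
    (hL : L '' copositiveCone n = copositiveCone n) :
    ∃ P : Matrix (Fin n) (Fin n) ℝ, IsNonnegMatrix P ∧
      ∀ x, 0 ≤ x → ∀ A, quadEval x (L A) = quadEval (P *ᵥ x) A := by
  have hsurj := surjective_of_image_copositiveCone hL
  choose! T hT0 hT using fun (x : Fin n → ℝ) (hx : 0 ≤ x) => exists_quadEval_comp hL hx
  have hsmul (c : ℝ) (hc : 0 ≤ c) (x : Fin n → ℝ) (hx : 0 ≤ x) : T (c • x) = c • T x :=
    eq_of_quadEval_eq (hT0 _ (smul_nonneg hc hx)) (smul_nonneg hc (hT0 x hx)) fun A => by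
      rw [← hT _ (smul_nonneg hc hx), quadEval_smul, quadEval_smul, hT x hx]
  have hzero : T 0 = 0 := by simpa using hsmul 0 le_rfl 0 le_rfl
  have hadd (x z : Fin n → ℝ) (hx : 0 ≤ x) (hz : 0 ≤ z) : T (x + z) = T x + T z := by
    by_cases hij : ∃ i j, T x j * T z i < T x i * T z j
    · obtain ⟨i, j, hij⟩ := hij
      have hxz (s : ℝ) (hs : 0 ≤ s) : 0 ≤ x + s • z := add_nonneg hx (smul_nonneg hs hz)
      have := eq_add_of_rankOne_path (y := fun s => T (x + s • z))
        (N := fun u w => x ⬝ᵥ ((L (symOuter u w) : Matrix (Fin n) (Fin n) ℝ) *ᵥ z)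
          + z ⬝ᵥ ((L (symOuter u w) : Matrix (Fin n) (Fin n) ℝ) *ᵥ x))
        (hT0 x hx) (hT0 z hz) (fun s hs => hT0 _ (hxz s hs)) (fun s hs u w => by
          rw [← quadEval_symOuter, ← hT _ (hxz s hs), quadEval_add_smul, hT x hx, hT z hz,
            quadEval_symOuter, quadEval_symOuter]) hij
      simpa using this
    -- All 2 × 2 minors vanish, so `T x` and `T z` are parallel; injectivity of `T` transfers this
    -- to `x` and `z`, and homogeneity suffices.
    · push Not at hij
      by_cases hb : ∃ j, T z j ≠ 0
      · obtain ⟨j, hj⟩ := hb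
        set c := T x j / T z j
        have hc : 0 ≤ c := div_nonneg (hT0 x hx j) (hT0 z hz j)
        have hab : T x = c • T z := by
          ext i
          have h1 := hij i j
          have h2 := hij j i
          simp only [Pi.smul_apply, smul_eq_mul, c]
          field_simp
          linarith
        have hxz : x = c • z := by
          refine eq_of_quadEval_eq hx (smul_nonneg hc hz) fun B => ?_
          obtain ⟨A, rfl⟩ := hsurj B
          rw [hT x hx, hab, quadEval_smul, quadEval_smul, hT z hz]
        rw [hab, hxz]
        have : c • z + z = (c + 1) • z := by rw [add_smul, one_smul]
        rw [this, hsmul _ (by positivity) z hz, add_smul, one_smul]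
      · push Not at hb
        have hTz : T z = 0 := funext hb
        have hz0 : z = 0 := by
          refine eq_of_quadEval_eq hz le_rfl fun B => ?_
          obtain ⟨A, rfl⟩ := hsurj B
          rw [hT z hz, hTz, hT 0 le_rfl, hzero]
        rw [hTz, hz0, add_zero, add_zero]
  have he (i : Fin n) : (0 : Fin n → ℝ) ≤ Pi.single i 1 := Pi.single_nonneg.2 zero_le_one
  have hsum (x : Fin n → ℝ) (hx : 0 ≤ x) (s : Finset (Fin n)) :
      T (∑ i ∈ s, x i • Pi.single i 1) = ∑ i ∈ s, x i • T (Pi.single i 1) := by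
    classical
    induction s using Finset.induction_on with
    | empty => simpa using hzero
    | insert i s hi ih =>
      rw [Finset.sum_insert hi, Finset.sum_insert hi, hadd _ _ (smul_nonneg (hx i) (he i))
        (Finset.sum_nonneg fun j _ => smul_nonneg (hx j) (he j)), ih, hsmul _ (hx i) _ (he i)]
  refine ⟨of fun k i => T (Pi.single i 1) k, fun k i => hT0 _ (he i) k, fun x hx A => ?_⟩
  have hTx : T x = (of fun k i => T (Pi.single i 1) k) *ᵥ x := by
    have h := hsum x hx Finset.univ
    rw [← pi_eq_sum_univ' x] at h
    rw [h]
    ext k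
    simp [mulVec, dotProduct, mul_comm]
  rw [hT x hx, hTx]

/-! ### Congruences and the main theorem -/

theorem quadEval_eq_of_coe_eq_mul_mul_transpose {n : ℕ} {Q : Matrix (Fin n) (Fin n) ℝ}
    {A B : symMatrices n}
    (h : (B : Matrix (Fin n) (Fin n) ℝ) = Q * (A : Matrix (Fin n) (Fin n) ℝ) * Qᵀ)
    (x : Fin n → ℝ) : quadEval x B = quadEval (Qᵀ *ᵥ x) A := by
  rw [quadEval_apply, quadEval_apply, h, ← mulVec_mulVec, ← mulVec_mulVec, dotProduct_mulVec,
    ← mulVec_transpose]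

theorem mul_mul_transpose_mem {n : ℕ} (Q : Matrix (Fin n) (Fin n) ℝ) (A : symMatrices n) :
    Q * (A : Matrix (Fin n) (Fin n) ℝ) * Qᵀ ∈ symMatrices n := by
  have hA : (A : Matrix (Fin n) (Fin n) ℝ)ᵀ = A := A.2
  change (Q * (A : Matrix (Fin n) (Fin n) ℝ) * Qᵀ)ᵀ = _
  rw [transpose_mul, transpose_mul, transpose_transpose, hA, Matrix.mul_assoc]

theorem mem_copositiveCone_of_coe_eq {n : ℕ} {Q : Matrix (Fin n) (Fin n) ℝ} (hQ : IsNonnegMatrix Q)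
    {A B : symMatrices n} (hA : A ∈ copositiveCone n)
    (h : (B : Matrix (Fin n) (Fin n) ℝ) = Q * (A : Matrix (Fin n) (Fin n) ℝ) * Qᵀ) :
    B ∈ copositiveCone n := by
  rw [mem_copositiveCone] at hA ⊢
  intro x hx
  rw [quadEval_eq_of_coe_eq_mul_mul_transpose h]
  have hQ' : IsNonnegMatrix Qᵀ := fun i j => hQ j i
  exact hA _ (hQ'.mulVec_nonneg hx)

theorem mainTheorem2 (n : ℕ) (L : symMatrices n →ₗ[ℝ] symMatrices n) :
    L '' copositiveCone n = copositiveCone n ↔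
      ∃ Q : Matrix (Fin n) (Fin n) ℝ, IsMonomialMatrix Q ∧ IsNonnegMatrix Q ∧
        ∀ A : symMatrices n,
          (L A : Matrix (Fin n) (Fin n) ℝ) = Q * (A : Matrix (Fin n) (Fin n) ℝ) * Qᵀ := by
  constructor
  · intro hL
    have hsurj := surjective_of_image_copositiveCone hL
    let e := LinearEquiv.ofBijective L ⟨LinearMap.injective_iff_surjective.2 hsurj, hsurj⟩
    have he : e.symm.toLinearMap '' copositiveCone n = copositiveCone n := by
      have h : e '' copositiveCone n = copositiveCone n := hL
      change e.symm '' copositiveCone n = copositiveCone n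
      rw [LinearEquiv.image_symm_eq_preimage, ← h, Set.preimage_image_eq _ e.injective, h]
    obtain ⟨P, hP0, hP⟩ := exists_nonneg_quadEval_mulVec hL
    obtain ⟨R, hR0, hR⟩ := exists_nonneg_quadEval_mulVec he
    have hRPx (x : Fin n → ℝ) (hx : 0 ≤ x) : R *ᵥ (P *ᵥ x) = x := by
      refine eq_of_quadEval_eq (hR0.mulVec_nonneg (hP0.mulVec_nonneg hx)) hx fun A => ?_
      rw [← hR _ (hP0.mulVec_nonneg hx), ← hP x hx]
      exact congrArg _ (e.apply_symm_apply A)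
    have hRP : R * P = 1 := by
      ext i j
      have h := congrFun (hRPx (Pi.single j 1) (Pi.single_nonneg.2 zero_le_one)) i
      rw [mulVec_mulVec, mulVec_single_one, col_apply] at h
      rw [h, one_apply, Pi.single_apply]
    have hPR : P * R = 1 := mul_eq_one_comm.1 hRP
    refine ⟨Pᵀ, isMonomialMatrix_of_nonneg_inverse (R := Rᵀ) (fun i j => hP0 j i)
      (fun i j => hR0 j i) (by rw [← transpose_mul, hRP, transpose_one])
      (by rw [← transpose_mul, hPR, transpose_one]), fun i j => hP0 j i, fun A => ?_⟩
    have h : L A - ⟨_, mul_mul_transpose_mem Pᵀ A⟩ = 0 :=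
      eq_zero_of_quadEval_eq_zero fun x hx => by
        rw [map_sub, hP x hx, quadEval_eq_of_coe_eq_mul_mul_transpose (Q := Pᵀ) (A := A)
            (B := ⟨_, mul_mul_transpose_mem Pᵀ A⟩) rfl,
          transpose_transpose, sub_self]
    exact congrArg Subtype.val (sub_eq_zero.1 h)
  · rintro ⟨Q, hQ, hQ0, hQL⟩
    obtain ⟨R, hR0, hQR⟩ := hQ.exists_nonneg_right_inverse hQ0
    refine Set.Subset.antisymm ?_ fun B hB => ?_
    · rintro _ ⟨A, hA, rfl⟩
      exact mem_copositiveCone_of_coe_eq hQ0 hA (hQL A)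
    · refine ⟨⟨_, mul_mul_transpose_mem R B⟩, mem_copositiveCone_of_coe_eq hR0 hB rfl, ?_⟩
      ext1
      rw [hQL]
      calc Q * (R * (B : Matrix (Fin n) (Fin n) ℝ) * Rᵀ) * Qᵀ
          = (Q * R) * (B : Matrix (Fin n) (Fin n) ℝ) * (Q * R)ᵀ := by
            simp only [transpose_mul, Matrix.mul_assoc]
        _ = B := by rw [hQR]; simp
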